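/- Let $m\ge 2$ be an integer, let $e_m(z)=e^{2\pi i z/m}$, and for an integer $x$ coprime to $m$ let $x^*$ denote the multiplicative inverse of $x$ modulo $m$. Let $a$ be an integer with $\gcd(a,m)=1$, let $N_1,N_2$ be positive integers, and let $\alpha_1(x_1)$ $(1\le x_1\le N_1)$ and $\alpha_2(x_2)$ $(1\le x_2\le N_2)$ be complex numbers with $|\alpha_1(x_1)|\le 1$ and $|\alpha_2(x_2)|\le 1$. Then for all positive integers $k_1,k_2$, $$\Biggl|\sum_{\substack{1\le x_1\le N_1\\ \gcd(x_1,m)=1}}\ \sum_{\substack{1\le x_2\le N_2\\ \gcd(x_2,m)=1}}\alpha_1(x_1)\alpha_2(x_2)\,e_m(a x_1^*x_2^*)\Biggr| < (2k_1)^{\frac{45k_1^2}{k_2}}(2k_2)^{\frac{45k_2^2}{k_1}}(\log m)^{2\left(\frac{k_1}{k_2}+\frac{k_2}{k_1}\right)}\left(\frac{N_1^{k_1-1}}{m^{1/2}}+\frac{m^{1/2}}{N_1^{k_1}}\right)^{\frac{1}{2k_1k_2}}\left(\frac{N_2^{k_2-1}}{m^{1/2}}+\frac{m^{1/2}}{N_2^{k_2}}\right)^{\frac{1}{2k_1k_2}}N_1N_2.$$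 -/

import Mathlib

/-- `e_m(z) = exp(2πiz/m)` for an integer `z`. -/
noncomputable def eMod (m : ℕ) (z : ℤ) : ℂ :=
  Complex.exp (2 * (Real.pi : ℂ) * Complex.I * (z : ℂ) / (m : ℂ))

/-- The representative `x^*` in `{0, …, m-1}` of the inverse of `x` modulo `m`; it is only used
for `x` coprime to `m`. -/
def invMod (m x : ℕ) : ℕ := ((x : ZMod m)⁻¹).val

/-- The set of integers `x` in the interval `[1, N]` that are coprime to `m`. -/
def coprimeInterval (m N : ℕ) : Finset ℕ := (Finset.Icc 1 N).filter (fun x => Nat.Coprime x m)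

/-- The bilinear Kloosterman sum of `α₁(x₁) α₂(x₂) e_m(a x₁^* x₂^*)` over `x₁ ∈ [1, N₁]` and
`x₂ ∈ [1, N₂]`, both variables being restricted to integers coprime to `m`. -/
noncomputable def bilinearKloosterman (m : ℕ) (a : ℤ) (N₁ N₂ : ℕ) (α₁ α₂ : ℕ → ℂ) : ℂ :=
  ∑ x₁ ∈ coprimeInterval m N₁, ∑ x₂ ∈ coprimeInterval m N₂,
    α₁ x₁ * α₂ x₂ * eMod m (a * (invMod m x₁ : ℤ) * (invMod m x₂ : ℤ))

/-! Let `J i` count the solutions of `x₁^* + … + x_k^* ≡ y₁^* + … + y_k^*` modulo `m`, with `k = kᵢ`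
and all variables in `[1, Nᵢ]` coprime to `m`. Two applications of Hölder's inequality replace each
variable by a tuple of inverses; Cauchy's inequality and Parseval then bound the `2 k₁ k₂`-th power
of the sum by `N₁ ^ (2 k₁ (k₂ - 1)) * N₂ ^ (2 k₂ (k₁ - 1)) * m * J 1 * J 2`
(`norm_bilinear_pow_le_coincidences`).

To bound `J` when `N < m`, write `∑ 1/xᵢ = A/B` with `A ≤ k N ^ (k - 1)` and `B ≤ N ^ k`. Fractions
in one class modulo `m` have cross products congruent modulo `m`, so distinct ones are well spaced,
and a class contains few of them (`card_le_of_cross_modEq`). This reduces the congruence to the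
equation `∑ 1/xᵢ = ∑ 1/yᵢ` in rationals. There the product of all `2k` variables is squarefull,
since a prime dividing only one denominator, to the first power, could not cancel; Rankin's trick
shows that such tuples number about `N ^ k`, up to logarithms (`card_squarefull_tuples_le`). When `N
≥ m`, fixing all variables but one suffices. -/

/-! ### Coincidences, Parseval and Cauchy. -/

/-- The number of pairs of elements of `s` on which `U` takes the same value. -/
def coincidences {A G : Type*} [DecidableEq G] (s : Finset A) (U : A → G) : ℕ :=
  (Finset.filter (fun p : A × A => U p.1 = U p.2) (s ×ˢ s)).card

theorem coincidences_eq_sum_sq {A G : Type*} [DecidableEq G] (s : Finset A) (U : A → G)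
    (t : Finset G) (h : ∀ x ∈ s, U x ∈ t) :
    coincidences s U = ∑ c ∈ t, ((s.filter (fun x => U x = c)).card) ^ 2 := by
  classical
  unfold coincidences
  rw [Finset.card_eq_sum_card_fiberwise (f := fun p : A × A => U p.1) (t := t)]
  · refine Finset.sum_congr rfl fun c _ => ?_
    rw [sq, ← Finset.card_product]
    congr 1
    ext ⟨x, y⟩
    simp only [Finset.mem_filter, Finset.mem_product]
    constructor
    · rintro ⟨⟨⟨hx, hy⟩, h1⟩, h2⟩
      exact ⟨⟨hx, h2⟩, hy, h1 ▸ h2⟩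
    · rintro ⟨⟨hx, h1⟩, hy, h2⟩
      exact ⟨⟨⟨hx, hy⟩, h1.trans h2.symm⟩, h1⟩
  · rintro ⟨x, y⟩ hp
    simp only [Finset.coe_filter, Finset.mem_product, Set.mem_ofPred_eq] at hp
    exact h _ hp.1.1

/-- Parseval: after expanding the square, orthogonality of characters leaves only the diagonal. -/
theorem sum_norm_sq_fourier {m : ℕ} [NeZero m] (ψ : AddChar (ZMod m) ℂ) (hψ : ψ.IsPrimitive)
    (g : ZMod m → ℂ) :
    ∑ c, ‖∑ d, g d * ψ (c * d)‖ ^ 2 = m * ∑ d, ‖g d‖ ^ 2 := by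
  have key : ∑ c, ((∑ d, g d * ψ (c * d)) * (starRingEnd ℂ) (∑ d, g d * ψ (c * d)))
      = m * ∑ d, g d * (starRingEnd ℂ) (g d) := by
    have h1 : ∀ c : ZMod m, (∑ d, g d * ψ (c * d)) * (starRingEnd ℂ) (∑ d, g d * ψ (c * d))
        = ∑ d, ∑ e, g d * (starRingEnd ℂ) (g e) * ψ (c * (d - e)) := by
      intro c
      rw [map_sum, Finset.sum_mul_sum]
      refine Finset.sum_congr rfl fun d _ => Finset.sum_congr rfl fun e _ => ?_
      rw [_root_.map_mul (starRingEnd ℂ), ← AddChar.inv_apply_eq_conj, mul_sub, AddChar.map_sub_eq_div]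
      ring
    simp_rw [h1]
    rw [Finset.sum_comm, Finset.mul_sum]
    refine Finset.sum_congr rfl fun d _ => ?_
    rw [Finset.sum_comm]
    simp_rw [← Finset.mul_sum, AddChar.sum_mulShift _ hψ, sub_eq_zero, ZMod.card]
    simp
    ring
  have h2 : ∀ z : ℂ, z * (starRingEnd ℂ) z = ((‖z‖ ^ 2 : ℝ) : ℂ) := fun z => by
    rw [Complex.mul_conj, Complex.normSq_eq_norm_sq]
  simp_rw [h2] at key
  exact_mod_cast key

theorem sum_norm_sq_fiber_le {A G : Type*} [DecidableEq G] [Fintype G] (s : Finset A) (U : A → G)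
    (θ : A → ℂ) (hθ : ∀ x ∈ s, ‖θ x‖ ≤ 1) :
    ∑ c, ‖∑ x ∈ s with U x = c, θ x‖ ^ 2 ≤ coincidences s U := by
  rw [coincidences_eq_sum_sq s U Finset.univ (by simp)]
  push_cast
  refine Finset.sum_le_sum fun c _ => ?_
  refine pow_le_pow_left₀ (norm_nonneg _) ?_ 2
  refine (norm_sum_le_of_le _ (fun x hx => hθ x (Finset.mem_filter.1 hx).1)).trans ?_
  simp

/-- Cauchy's bound for bilinear sums with a primitive additive character. -/
theorem norm_sq_bilinear_le {m : ℕ} [NeZero m] (ψ : AddChar (ZMod m) ℂ) (hψ : ψ.IsPrimitive)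
    {A B : Type*} (s : Finset A) (t : Finset B) (U : A → ZMod m) (V : B → ZMod m)
    (θ : A → ℂ) (η : B → ℂ) (hθ : ∀ x ∈ s, ‖θ x‖ ≤ 1) (hη : ∀ x ∈ t, ‖η x‖ ≤ 1) :
    ‖∑ x ∈ s, ∑ y ∈ t, θ x * η y * ψ (U x * V y)‖ ^ 2
      ≤ m * coincidences s U * coincidences t V := by
  set f : ZMod m → ℂ := fun c => ∑ x ∈ s with U x = c, θ x
  set g : ZMod m → ℂ := fun c => ∑ x ∈ t with V x = c, η x
  -- Collecting terms by the values `c` of `U` and `d` of `V` makes the sum a bilinear form in the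
  -- Fourier matrix.
  have h1 : ∑ x ∈ s, ∑ y ∈ t, θ x * η y * ψ (U x * V y) = ∑ c, f c * ∑ d, g d * ψ (c * d) := by
    rw [← Finset.sum_fiberwise s U]
    refine Finset.sum_congr rfl fun c _ => ?_
    rw [Finset.sum_mul]
    refine Finset.sum_congr rfl fun x hx => ?_
    rw [← Finset.sum_fiberwise t V, Finset.mul_sum]
    refine Finset.sum_congr rfl fun d _ => ?_
    rw [Finset.sum_mul, Finset.mul_sum]
    refine Finset.sum_congr rfl fun y hy => ?_
    rw [(Finset.mem_filter.1 hx).2, (Finset.mem_filter.1 hy).2]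
    ring
  rw [h1]
  calc ‖∑ c, f c * ∑ d, g d * ψ (c * d)‖ ^ 2
      ≤ (∑ c, ‖f c‖ * ‖∑ d, g d * ψ (c * d)‖) ^ 2 := by
        refine pow_le_pow_left₀ (norm_nonneg _) ?_ 2
        exact norm_sum_le_of_le _ fun c _ => (norm_mul _ _).le
    _ ≤ (∑ c, ‖f c‖ ^ 2) * ∑ c, ‖∑ d, g d * ψ (c * d)‖ ^ 2 :=
        Finset.sum_mul_sq_le_sq_mul_sq _ _ _
    _ = m * (∑ c, ‖f c‖ ^ 2) * ∑ d, ‖g d‖ ^ 2 := by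
        rw [sum_norm_sq_fourier ψ hψ]; ring
    _ ≤ m * coincidences s U * coincidences t V := by
        gcongr
        · exact sum_norm_sq_fiber_le s U θ hθ
        · exact sum_norm_sq_fiber_le t V η hη

/-! ### Hölder's inequality and passage to tuples. -/

theorem sum_pow_le_card_pow_mul {A : Type*} (s : Finset A) (f : A → ℝ) (hf : ∀ x ∈ s, 0 ≤ f x)
    {k : ℕ} (hk : 1 ≤ k) : (∑ x ∈ s, f x) ^ k ≤ (s.card : ℝ) ^ (k - 1) * ∑ x ∈ s, f x ^ k := by
  obtain ⟨n, rfl⟩ : ∃ n, k = n + 1 := ⟨k - 1, by omega⟩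
  exact pow_sum_le_card_mul_sum_pow hf n

/-- Such phases turn a sum of norms into a linear expression, whose order of summation can be
exchanged. -/
theorem exists_unimodular_mul_eq_norm (z : ℂ) : ∃ w : ℂ, ‖w‖ ≤ 1 ∧ (‖z‖ : ℂ) = w * z := by
  by_cases hz : z = 0
  · exact ⟨0, by simp [hz]⟩
  · refine ⟨‖z‖ / z, by simp [hz], by field_simp⟩

/-- The power of a linear form in values of a character, expanded over tuples. -/
theorem sum_pow_eq_sum_tuples {m : ℕ} (ψ : AddChar (ZMod m) ℂ)
    {B : Type*} (t : Finset B) (v : B → ZMod m) (β : B → ℂ) (u : ZMod m) (k : ℕ) :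
    (∑ y ∈ t, β y * ψ (u * v y)) ^ k =
      ∑ p ∈ Fintype.piFinset fun _ : Fin k => t,
        (∏ i, β (p i)) * ψ (u * ∑ i, v (p i)) := by
  rw [Finset.sum_pow']
  refine Finset.sum_congr rfl fun p _ => ?_
  rw [Finset.prod_mul_distrib, Finset.mul_sum]
  congr 1
  exact (map_prod ψ.toMonoidHom (fun i => Multiplicative.ofAdd (u * v (p i))) Finset.univ).symm

/-- Double Hölder: moving the sum over one variable into tuples. -/
theorem norm_bilinear_pow_le {m : ℕ} [NeZero m] (ψ : AddChar (ZMod m) ℂ)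
    {A B : Type*} (s : Finset A) (t : Finset B) (u : A → ZMod m) (v : B → ZMod m)
    (α : A → ℂ) (β : B → ℂ) (hα : ∀ x ∈ s, ‖α x‖ ≤ 1) {k : ℕ} (hk : 1 ≤ k) :
    ∃ θ : A → ℂ, (∀ x ∈ s, ‖θ x‖ ≤ 1) ∧
    ‖∑ x ∈ s, ∑ y ∈ t, α x * β y * ψ (u x * v y)‖ ^ k ≤ (s.card : ℝ) ^ (k - 1) *
      ‖∑ p ∈ Fintype.piFinset fun _ : Fin k => t, (∏ i, β (p i)) *
          ∑ x ∈ s, θ x * ψ (u x * ∑ i, v (p i))‖ := by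
  choose w hw1 hw using exists_unimodular_mul_eq_norm
  set F : A → ℂ := fun x => ∑ y ∈ t, β y * ψ (u x * v y)
  refine ⟨fun x => w (F x ^ k), fun x _ => hw1 _, ?_⟩
  have h1 : ‖∑ x ∈ s, ∑ y ∈ t, α x * β y * ψ (u x * v y)‖ ≤ ∑ x ∈ s, ‖F x‖ := by
    refine norm_sum_le_of_le _ fun x hx => ?_
    have : ∑ y ∈ t, α x * β y * ψ (u x * v y) = α x * F x := by
      simp only [F, Finset.mul_sum, mul_assoc]
    rw [this, norm_mul]
    exact mul_le_of_le_one_left (norm_nonneg _) (hα x hx)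
  refine (pow_le_pow_left₀ (norm_nonneg _) h1 k).trans ?_
  refine (sum_pow_le_card_pow_mul s _ (fun _ _ => norm_nonneg _) hk).trans ?_
  gcongr
  have h2 : (∑ x ∈ s, ‖F x‖ ^ k : ℝ) = ‖((∑ x ∈ s, ‖F x‖ ^ k : ℝ) : ℂ)‖ := by
    rw [Complex.norm_real, Real.norm_of_nonneg (Finset.sum_nonneg fun _ _ => by positivity)]
  rw [h2]
  refine le_of_eq (congrArg norm ?_)
  push_cast
  simp_rw [← Complex.ofReal_pow, ← norm_pow, hw]
  simp_rw [Finset.mul_sum s]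
  rw [Finset.sum_comm]
  refine Finset.sum_congr rfl fun x _ => ?_
  rw [show F x ^ k = _ from sum_pow_eq_sum_tuples ψ t v β (u x) k, Finset.mul_sum]
  exact Finset.sum_congr rfl fun p _ => by rw [mul_left_comm]

/-- Karatsuba's bound for a bilinear sum in terms of the numbers of coincidences among sums
of `k₁` and `k₂` terms. -/
theorem norm_bilinear_pow_le_coincidences {m : ℕ} [NeZero m] (ψ : AddChar (ZMod m) ℂ)
    (hψ : ψ.IsPrimitive)
    {A B : Type*} (s : Finset A) (t : Finset B) (u : A → ZMod m) (v : B → ZMod m)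
    (α : A → ℂ) (β : B → ℂ) (hα : ∀ x ∈ s, ‖α x‖ ≤ 1) (hβ : ∀ x ∈ t, ‖β x‖ ≤ 1)
    {k l : ℕ} (hk : 1 ≤ k) (hl : 1 ≤ l) :
    ‖∑ x ∈ s, ∑ y ∈ t, α x * β y * ψ (u x * v y)‖ ^ (2 * k * l) ≤
      (s.card : ℝ) ^ (2 * k * (l - 1)) * (t.card : ℝ) ^ (2 * l * (k - 1)) * (m *
      coincidences (Fintype.piFinset fun _ : Fin k => s) (fun p => ∑ i, u (p i)) *
      coincidences (Fintype.piFinset fun _ : Fin l => t) (fun p => ∑ i, v (p i))) := by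
  obtain ⟨θ, hθ, h1⟩ := norm_bilinear_pow_le ψ s t u v α β hα hl
  set T := Fintype.piFinset fun _ : Fin l => t
  set S := Fintype.piFinset fun _ : Fin k => s
  have hB : ∀ p ∈ T, ‖∏ i, β (p i)‖ ≤ 1 := fun p hp => by
    rw [norm_prod]
    exact Finset.prod_le_one (fun _ _ => norm_nonneg _)
      fun i _ => hβ _ (Fintype.mem_piFinset.1 hp i)
  have hA : ∀ p ∈ S, ‖∏ i, θ (p i)‖ ≤ 1 := fun p hp => by
    rw [norm_prod]
    exact Finset.prod_le_one (fun _ _ => norm_nonneg _)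
      fun i _ => hθ _ (Fintype.mem_piFinset.1 hp i)
  -- The second Hölder swaps the roles: the `l`-tuples in `T` are now the outer variable, and the
  -- phases `θ` from the first application are the inner coefficients.
  obtain ⟨η, hη, h2⟩ := norm_bilinear_pow_le ψ T s (fun p => ∑ i, v (p i)) u
    (fun p => ∏ i, β (p i)) θ hB hk
  have h3 := norm_sq_bilinear_le ψ hψ S T (fun p => ∑ i, u (p i)) (fun p => ∑ i, v (p i))
    (fun p => ∏ i, θ (p i)) η hA hη
  set X := ‖∑ x ∈ s, ∑ y ∈ t, α x * β y * ψ (u x * v y)‖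
  set Y := ‖∑ p ∈ T, (∏ i, β (p i)) * ∑ x ∈ s, θ x * ψ (u x * ∑ i, v (p i))‖
  have hY : ‖∑ x ∈ T, ∑ y ∈ s, (∏ i, β (x i)) * θ y * ψ ((∑ i, v (x i)) * u y)‖ = Y := by
    simp only [Y, Finset.mul_sum s]
    congr 1
    refine Finset.sum_congr rfl fun p _ => Finset.sum_congr rfl fun x _ => ?_
    rw [mul_comm (u x), mul_assoc]
  have hZ : ∑ p ∈ S, (∏ i, θ (p i)) * ∑ x ∈ T, η x * ψ ((∑ i, v (x i)) * ∑ i, u (p i))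
      = ∑ x ∈ S, ∑ y ∈ T, (∏ i, θ (x i)) * η y * ψ ((∑ i, u (x i)) * (∑ i, v (y i))) := by
    simp only [Finset.mul_sum T]
    refine Finset.sum_congr rfl fun p _ => Finset.sum_congr rfl fun x _ => ?_
    rw [mul_comm (∑ i, v (x i)), mul_assoc]
  rw [hY, hZ] at h2
  set Z := ‖∑ x ∈ S, ∑ y ∈ T, (∏ i, θ (x i)) * η y * ψ ((∑ i, u (x i)) * (∑ i, v (y i)))‖
  have hT : (T.card : ℝ) = (t.card : ℝ) ^ l := by
    simp [T]
  calc X ^ (2 * k * l) = ((X ^ l) ^ k) ^ 2 := by rw [← pow_mul, ← pow_mul]; ring_nf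
    _ ≤ (((s.card : ℝ) ^ (l - 1) * Y) ^ k) ^ 2 := by gcongr
    _ = (((s.card : ℝ) ^ (l - 1)) ^ k * Y ^ k) ^ 2 := by rw [mul_pow]
    _ ≤ (((s.card : ℝ) ^ (l - 1)) ^ k * (((t.card : ℝ) ^ l) ^ (k - 1) * Z)) ^ 2 := by
        rw [← hT]; gcongr
    _ = (s.card : ℝ) ^ (2 * k * (l - 1)) * (t.card : ℝ) ^ (2 * l * (k - 1)) * Z ^ 2 := by
        rw [mul_pow, mul_pow, ← pow_mul, ← pow_mul, ← pow_mul, ← pow_mul]; ring_nf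
    _ ≤ _ := by gcongr

/-! ### From congruences to equations in rationals. -/

/-- If on each fibre of `U` the map `V` takes at most `K` values, then the coincidences of `U`
are at most `K` times those of `V`. -/
theorem coincidences_le_mul {A G H : Type*} [DecidableEq G] [DecidableEq H] (s : Finset A)
    (U : A → G) (V : A → H) (K : ℝ)
    (hK : ∀ T : Finset A, T ⊆ s → (∀ x ∈ T, ∀ y ∈ T, U x = U y) → Set.InjOn V T → (T.card : ℝ) ≤ K) :
    (coincidences s U : ℝ) ≤ K * coincidences s V := by
  classical
  have hK0 : 0 ≤ K := by simpa using hK ∅ (by simp) (by simp) (by simp)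
  rw [coincidences_eq_sum_sq s U (s.image U) fun x hx => Finset.mem_image_of_mem _ hx]
  have h2 : ∀ c ∈ s.image U, (((s.filter (fun x => U x = c)).card : ℝ)) ^ 2 ≤
      K * coincidences (s.filter (fun x => U x = c)) V := by
    intro c _
    set F := s.filter (fun x => U x = c) with hF
    have hmap : ∀ x ∈ F, V x ∈ F.image V := fun x hx => Finset.mem_image_of_mem _ hx
    have hcard : F.card = ∑ b ∈ F.image V, (F.filter (fun x => V x = b)).card :=
      Finset.card_eq_sum_card_fiberwise fun x hx => by simpa using hmap x hx
    -- `T` picks one point of the fibre for each value of `V`, so `hK` bounds the number of values;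
    -- Cauchy's inequality over these values does the rest.
    obtain ⟨T, hTF, hTinj, hTimg⟩ := Finset.exists_subset_injOn_image_eq_of_surjOn
      (f := V) (F : Set A) (F.image V) (by rw [Finset.coe_image]; exact Set.surjOn_image _ _)
    replace hTF : T ⊆ F := by exact_mod_cast hTF
    rw [coincidences_eq_sum_sq F V _ hmap, hcard]
    push_cast
    refine sq_sum_le_card_mul_sum_sq.trans
      (mul_le_mul_of_nonneg_right ?_ (Finset.sum_nonneg fun _ _ => by positivity))
    have hcT : (F.image V).card = T.card := hTimg ▸ Finset.card_image_of_injOn hTinj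
    rw [hcT]
    refine hK T (hTF.trans (Finset.filter_subset _ _)) (fun x hx y hy => ?_) hTinj
    rw [(Finset.mem_filter.1 (hTF hx)).2, (Finset.mem_filter.1 (hTF hy)).2]
  push_cast
  refine (Finset.sum_le_sum h2).trans ?_
  rw [← Finset.mul_sum]
  gcongr
  norm_cast
  unfold coincidences
  rw [← Finset.card_biUnion]
  · refine Finset.card_le_card fun p hp => ?_
    simp only [Finset.mem_biUnion, Finset.mem_filter, Finset.mem_product] at hp ⊢
    obtain ⟨c, _, ⟨⟨h1, _⟩, h2, _⟩, h3⟩ := hp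
    exact ⟨⟨h1, h2⟩, h3⟩
  · intro c _ d _ hcd
    refine Finset.disjoint_left.2 fun p hp hq => hcd ?_
    simp only [Finset.mem_filter, Finset.mem_product] at hp hq
    exact hp.1.1.2.symm.trans hq.1.1.2

/-- Points of a lattice of determinant `m` with distinct slopes, in a triangle. -/
theorem card_le_of_cross_modEq_of_slope_le {A : Type*} (T : Finset A) (a b : A → ℕ) {m : ℕ}
    (hm : 0 < m) {X Y : ℝ} (hX : 0 < X) (hY : 0 < Y) (hb : ∀ x ∈ T, 0 < b x ∧ (b x : ℝ) ≤ Y)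
    (hslope : ∀ x ∈ T, (a x : ℝ) * Y ≤ X * b x)
    (hT : ∀ x ∈ T, ∀ y ∈ T, x ≠ y → a x * b y ≠ a y * b x)
    (hmod : ∀ x ∈ T, ∀ y ∈ T, a x * b y ≡ a y * b x [MOD m]) :
    (T.card : ℝ) ≤ X * Y / m + 1 := by
  have hm' : (0 : ℝ) < m := by exact_mod_cast hm
  -- Distinct slopes `a / b` differ by at least `m / (b x * b y) ≥ m / Y ^ 2`. Scaled by `Y ^ 2 / m`
  -- they are 1-spaced and at most `X * Y / m`, so their floors are distinct.
  set f : A → ℕ := fun x => ⌊(a x : ℝ) * Y ^ 2 / (b x * m)⌋₊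
  have hmaps : ∀ x ∈ T, f x ∈ Finset.range (⌊X * Y / m⌋₊ + 1) := by
    intro x hx
    rw [Finset.mem_range, Nat.lt_succ_iff]
    apply Nat.floor_le_floor
    have h1 := hb x hx
    have h2 : (0 : ℝ) < b x := by exact_mod_cast h1.1
    rw [div_le_div_iff₀ (by positivity) hm']
    have := hslope x hx
    calc (a x : ℝ) * Y ^ 2 * m = (a x * Y) * (Y * m) := by ring
      _ ≤ (X * b x) * (Y * m) := by gcongr
      _ = _ := by ring
  have key : ∀ x ∈ T, ∀ y ∈ T, a x * b y < a y * b x → f x < f y := by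
    intro x hx y hy hlt
    have h1 : m ≤ a y * b x - a x * b y :=
      Nat.le_of_dvd (by omega) ((Nat.modEq_iff_dvd' hlt.le).1 (hmod x hx y hy))
    have h1' : (m : ℝ) + a x * b y ≤ a y * b x := by
      have : m + a x * b y ≤ a y * b x := by omega
      exact_mod_cast this
    obtain ⟨hbx, hbx'⟩ := hb x hx
    obtain ⟨hby, hby'⟩ := hb y hy
    have hbx0 : (0 : ℝ) < b x := by exact_mod_cast hbx
    have hby0 : (0 : ℝ) < b y := by exact_mod_cast hby
    have h2 : (a x : ℝ) * Y ^ 2 / (b x * m) + 1 ≤ (a y : ℝ) * Y ^ 2 / (b y * m) := by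
      rw [div_add_one (by positivity), div_le_div_iff₀ (by positivity) (by positivity)]
      have h3 : (b x : ℝ) * b y ≤ Y ^ 2 := by nlinarith
      have h4 : (m : ℝ) * (b x * b y) ≤ m * Y ^ 2 := by gcongr
      have h5 : ((m : ℝ) + a x * b y) * (Y ^ 2 * m) ≤ (a y * b x) * (Y ^ 2 * m) := by gcongr
      nlinarith
    have h3 : f x + 1 ≤ f y := by
      simp only [f]
      rw [← Nat.floor_add_one (by positivity)]
      exact Nat.floor_le_floor h2
    omega
  have hinj : Set.InjOn f T := by
    intro x hx y hy hxy
    by_contra hne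
    rcases lt_or_gt_of_ne (hT x hx y hy hne) with h | h
    · exact absurd hxy (key x hx y hy h).ne
    · exact absurd hxy (key y hy x hx h).ne'
  have hc := Finset.card_le_card_of_injOn f hmaps hinj
  rw [Finset.card_range] at hc
  have h1 : (T.card : ℝ) ≤ (⌊X * Y / m⌋₊ : ℝ) + 1 := by exact_mod_cast hc
  linarith [Nat.floor_le (show 0 ≤ X * Y / m by positivity)]

/-- Points of a lattice of determinant `m` with distinct slopes, in a rectangle. -/
theorem card_le_of_cross_modEq {A : Type*} (T : Finset A) (a b : A → ℕ) {m : ℕ}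
    (hm : 0 < m) {X Y : ℝ} (hX : 0 < X) (hY : 0 < Y)
    (ha : ∀ x ∈ T, 0 < a x ∧ (a x : ℝ) ≤ X) (hb : ∀ x ∈ T, 0 < b x ∧ (b x : ℝ) ≤ Y)
    (hT : ∀ x ∈ T, ∀ y ∈ T, x ≠ y → a x * b y ≠ a y * b x)
    (hmod : ∀ x ∈ T, ∀ y ∈ T, a x * b y ≡ a y * b x [MOD m]) :
    (T.card : ℝ) ≤ 2 * (X * Y / m + 1) := by
  classical
  -- The diagonal cuts the rectangle into two triangles; above it the coordinates are exchanged so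
  -- that slopes stay bounded.
  have h1 := card_le_of_cross_modEq_of_slope_le (T.filter fun x => (a x : ℝ) * Y ≤ X * b x) a b hm
    hX hY (fun x hx => hb x (Finset.mem_filter.1 hx).1) (fun x hx => (Finset.mem_filter.1 hx).2)
    (fun x hx y hy => hT x (Finset.mem_filter.1 hx).1 y (Finset.mem_filter.1 hy).1)
    (fun x hx y hy => hmod x (Finset.mem_filter.1 hx).1 y (Finset.mem_filter.1 hy).1)
  have h2 := card_le_of_cross_modEq_of_slope_le (T.filter fun x => ¬ (a x : ℝ) * Y ≤ X * b x) b a hm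
    hY hX (fun x hx => ha x (Finset.mem_filter.1 hx).1)
    (fun x hx => by linarith [(Finset.mem_filter.1 hx).2])
    (fun x hx y hy hxy h => hT y (Finset.mem_filter.1 hy).1 x (Finset.mem_filter.1 hx).1 hxy.symm
      (by linarith))
    (fun x hx y hy => by
      have := hmod y (Finset.mem_filter.1 hy).1 x (Finset.mem_filter.1 hx).1
      rwa [mul_comm (a y), mul_comm (a x)] at this)
  have h3 := Finset.card_filter_add_card_filter_not (s := T) (fun x => (a x : ℝ) * Y ≤ X * b x)
  have h4 : (T.card : ℝ) = ((T.filter fun x => (a x : ℝ) * Y ≤ X * b x).card : ℝ) +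
    ((T.filter fun x => ¬ (a x : ℝ) * Y ≤ X * b x).card : ℝ) := by exact_mod_cast h3.symm
  rw [mul_comm Y X] at h2
  linarith

/-- The numerator of `∑ 1 / p i` over the common denominator `∏ p i`. -/
def reciprocalNumerator {k : ℕ} (p : Fin k → ℕ) : ℕ := ∑ i, ∏ j ∈ Finset.univ.erase i, p j

/-- Stated over a general ring to serve both `ℚ` and `ZMod m`. -/
theorem cast_reciprocalNumerator {k : ℕ} {R : Type*} [CommRing R] (p : Fin k → ℕ) (q : Fin k → R)
    (h : ∀ i, (p i : R) * q i = 1) :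
    (reciprocalNumerator p : R) = (∏ i, (p i : R)) * ∑ i, q i := by
  rw [reciprocalNumerator, Finset.mul_sum]
  push_cast
  refine Finset.sum_congr rfl fun i _ => ?_
  rw [← Finset.mul_prod_erase Finset.univ _ (Finset.mem_univ i), mul_right_comm, h, one_mul]

theorem reciprocalNumerator_pos {k : ℕ} (hk : 1 ≤ k) (p : Fin k → ℕ) (h : ∀ i, 1 ≤ p i) :
    0 < reciprocalNumerator p := by
  have : Nonempty (Fin k) := ⟨⟨0, hk⟩⟩
  exact Finset.sum_pos (fun i _ => Finset.prod_pos fun j _ => h j) Finset.univ_nonempty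

theorem reciprocalNumerator_le {k : ℕ} (p : Fin k → ℕ) {N : ℕ} (h : ∀ i, p i ≤ N) :
    reciprocalNumerator p ≤ k * N ^ (k - 1) := by
  have : ∀ i ∈ (Finset.univ : Finset (Fin k)),
      ∏ j ∈ Finset.univ.erase i, p j ≤ N ^ (k - 1) := fun i hi => by
    refine (Finset.prod_le_pow_card _ _ N fun j _ => h j).trans ?_
    rw [Finset.card_erase_of_mem hi]; simp
  simpa [reciprocalNumerator] using Finset.sum_le_card_nsmul _ _ _ this

theorem mem_coprimeInterval {m N x : ℕ} :
    x ∈ coprimeInterval m N ↔ (1 ≤ x ∧ x ≤ N) ∧ x.Coprime m := by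
  simp [coprimeInterval]

theorem natCast_mul_inv_of_mem {m N x : ℕ} (h : x ∈ coprimeInterval m N) :
    (x : ZMod m) * (x : ZMod m)⁻¹ = 1 :=
  ZMod.coe_mul_inv_eq_one x (mem_coprimeInterval.1 h).2

/-- Passing from the congruence `∑ 1/x ≡ ∑ 1/y` modulo `m` to the equation in rationals. -/
theorem coincidences_mod_le_rat (m : ℕ) (hm : 2 ≤ m) (N : ℕ) (hN : 1 ≤ N) (k : ℕ) (hk : 1 ≤ k) :
    (coincidences (Fintype.piFinset fun _ : Fin k => coprimeInterval m N)
      (fun p => ∑ i, ((p i : ℕ) : ZMod m)⁻¹) : ℝ) ≤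
    2 * (k * (N : ℝ) ^ (2 * k - 1) / m + 1) *
      coincidences (Fintype.piFinset fun _ : Fin k => coprimeInterval m N)
      (fun p => ∑ i, ((p i : ℕ) : ℚ)⁻¹) := by
  refine coincidences_le_mul _ _ _ _ fun T hTs hU hV => ?_
  have hmem : ∀ p ∈ T, ∀ i, p i ∈ coprimeInterval m N := fun p hp =>
    Fintype.mem_piFinset.1 (hTs hp)
  have hpos : ∀ p ∈ T, ∀ i, 1 ≤ p i := fun p hp i => (mem_coprimeInterval.1 (hmem p hp i)).1.1
  have hle : ∀ p ∈ T, ∀ i, p i ≤ N := fun p hp i => (mem_coprimeInterval.1 (hmem p hp i)).1.2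
  have hN' : (0 : ℝ) < N := by exact_mod_cast hN
  have hk' : (0 : ℝ) < k := by exact_mod_cast hk
  have hprodpos : ∀ p ∈ T, 0 < ∏ i, p i := fun p hp => Finset.prod_pos fun i _ => hpos p hp i
  have key := card_le_of_cross_modEq T reciprocalNumerator (fun p => ∏ i, p i)
    (m := m) (by omega) (X := k * (N : ℝ) ^ (k - 1)) (Y := (N : ℝ) ^ k) (by positivity)
    (by positivity)
    (fun p hp => ⟨reciprocalNumerator_pos hk p (hpos p hp), by
      exact_mod_cast reciprocalNumerator_le p (hle p hp)⟩)
    (fun p hp => ⟨hprodpos p hp, by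
      have := Finset.prod_le_pow_card Finset.univ p N fun i _ => hle p hp i
      simp only [Finset.card_univ, Fintype.card_fin] at this
      exact_mod_cast this⟩)
    (fun p hp q hq hpq h => hpq (hV hp hq ?_))
    (fun p hp q hq => ?_)
  · convert key using 2
    rw [mul_assoc, ← pow_add]
    congr 4
    omega
  · have h1 : ∀ r ∈ T, (reciprocalNumerator r : ℚ) = (∏ i, (r i : ℚ)) * ∑ i, (r i : ℚ)⁻¹ :=
      fun r hr => cast_reciprocalNumerator r _ fun i => mul_inv_cancel₀ (by
        have := hpos r hr i
        positivity)
    have h2 : (reciprocalNumerator p : ℚ) * ∏ i, (q i : ℚ) =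
        (reciprocalNumerator q : ℚ) * ∏ i, (p i : ℚ) := by exact_mod_cast h
    have hp0 : (∏ i, (p i : ℚ)) ≠ 0 := by exact_mod_cast (hprodpos p hp).ne'
    have hq0 : (∏ i, (q i : ℚ)) ≠ 0 := by exact_mod_cast (hprodpos q hq).ne'
    rw [h1 p hp, h1 q hq] at h2
    apply mul_left_cancel₀ (mul_ne_zero hp0 hq0)
    linear_combination h2
  · rw [← ZMod.natCast_eq_natCast_iff]
    push_cast
    rw [cast_reciprocalNumerator p _ fun i => natCast_mul_inv_of_mem (hmem p hp i),
      cast_reciprocalNumerator q _ fun i => natCast_mul_inv_of_mem (hmem q hq i), hU p hp q hq]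
    ring

/-! ### Squarefull products and Rankin's trick. -/

/-- Every prime divisor divides at least twice. -/
def IsSquarefull (n : ℕ) : Prop := ∀ p : ℕ, p.Prime → p ∣ n → p ^ 2 ∣ n

/-- The multiplicity of an index in a pair or a triple of indices. -/
def pairTripleMult {ι : Type*} [DecidableEq ι] : (ι × ι) ⊕ (ι × ι × ι) → ι → ℕ
  | Sum.inl (i, j) => Pi.single i 1 + Pi.single j 1
  | Sum.inr (i, j, l) => Pi.single i 1 + Pi.single j 1 + Pi.single l 1

theorem exists_eq_mul_pow_single {ι : Type*} [Fintype ι] [DecidableEq ι] {p : ℕ} (hp : p.Prime)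
    (x : ι → ℕ) (h : p ∣ ∏ i, x i) :
    ∃ (i : ι) (y : ι → ℕ), (∀ j, x j = y j * p ^ (Pi.single i 1 : ι → ℕ) j) ∧
      ∏ j, x j = (∏ j, y j) * p := by
  obtain ⟨i, _, a, ha⟩ := (hp.prime.dvd_finsetProd_iff _).1 h
  have hx : ∀ j, x j = Function.update x i a j * p ^ (Pi.single i 1 : ι → ℕ) j := by
    intro j
    by_cases hj : j = i
    · subst hj; simp [ha, mul_comm]
    · simp [hj]
  refine ⟨i, Function.update x i a, hx, ?_⟩
  rw [Finset.prod_congr rfl fun j _ => hx j, Finset.prod_mul_distrib, Finset.prod_pow_eq_pow_sum,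
    Finset.sum_pi_single']
  simp

theorem IsSquarefull.of_mul_prime_pow {n p e : ℕ} (hp : p.Prime) (h : IsSquarefull (n * p ^ e))
    (hn : p ∣ n → p ^ 2 ∣ n) : IsSquarefull n := by
  intro r hr hrn
  by_cases hrp : r = p
  · subst hrp; exact hn hrn
  · have hc : Nat.Coprime (r ^ 2) (p ^ e) := Nat.Coprime.pow _ _ ((Nat.coprime_primes hr hp).2 hrp)
    exact hc.dvd_of_dvd_mul_right (h r hr (hrn.mul_right _))

/-- A tuple of positive integers with squarefull product is built from factors shared by a pair
of entries or by a triple of entries. -/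
theorem exists_eq_prod_pow_of_isSquarefull {ι : Type*} [Fintype ι] [DecidableEq ι] (n : ℕ) :
    ∀ x : ι → ℕ, (∏ i, x i = n) → n ≠ 0 → IsSquarefull n →
      ∃ d : (ι × ι) ⊕ (ι × ι × ι) → ℕ, ∀ i, x i = ∏ q, d q ^ pairTripleMult q i := by
  induction n using Nat.strong_induction_on with
  | _ n ih =>
  intro x hx hn hsq
  by_cases h1 : n = 1
  · refine ⟨fun _ => 1, fun i => ?_⟩
    have : x i ∣ 1 := by rw [← h1, ← hx]; exact Finset.dvd_prod_of_mem x (Finset.mem_univ i)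
    simpa using this
  obtain ⟨p, hp, hpn⟩ := Nat.exists_prime_and_dvd h1
  -- Induction step: strip `p ^ e` spread over the indices of `q₀`, decompose the smaller tuple, and
  -- multiply its parameter at `q₀` by `p`.
  have step : ∀ (q₀ : (ι × ι) ⊕ (ι × ι × ι)) (y : ι → ℕ) (e : ℕ), 1 ≤ e →
      (∀ i, x i = y i * p ^ pairTripleMult q₀ i) → n = (∏ i, y i) * p ^ e →
      (p ∣ ∏ i, y i → p ^ 2 ∣ ∏ i, y i) →
      ∃ d : (ι × ι) ⊕ (ι × ι × ι) → ℕ, ∀ i, x i = ∏ q, d q ^ pairTripleMult q i := by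
    intro q₀ y e he hxy hny hpy
    have hy0 : ∏ i, y i ≠ 0 := fun h => hn (by rw [hny, h, zero_mul])
    have hlt : ∏ i, y i < n := by
      rw [hny]
      exact lt_mul_of_one_lt_right (Nat.pos_of_ne_zero hy0) (Nat.one_lt_pow (by omega) hp.one_lt)
    obtain ⟨d, hd⟩ := ih _ hlt y rfl hy0 (IsSquarefull.of_mul_prime_pow hp (hny ▸ hsq) hpy)
    refine ⟨fun q => d q * if q = q₀ then p else 1, fun i => ?_⟩
    simp_rw [mul_pow, Finset.prod_mul_distrib, ite_pow, one_pow]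
    rw [Finset.prod_ite_eq' Finset.univ q₀]
    simp [hxy i, hd i]
  obtain ⟨i, y, hxy, hy⟩ := exists_eq_mul_pow_single hp x (hx ▸ hpn)
  rw [hx] at hy
  have hpy : p ∣ ∏ j, y j := by
    have := hsq p hp hpn
    rw [hy, sq] at this
    exact Nat.dvd_of_mul_dvd_mul_right hp.pos this
  obtain ⟨j, z, hyz, hz⟩ := exists_eq_mul_pow_single hp y hpy
  -- After two factors `p` are removed, a single leftover `p` would spoil squarefullness; it is then
  -- taken too, giving a triple instead of a pair.
  by_cases h3 : p ∣ ∏ j, z j ∧ ¬ p ^ 2 ∣ ∏ j, z j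
  · obtain ⟨l, w, hzw, hw⟩ := exists_eq_mul_pow_single hp z h3.1
    refine step (Sum.inr (i, j, l)) w 3 (by norm_num) (fun r => ?_) ?_ (fun h => ?_)
    · rw [hxy, hyz, hzw]
      simp only [pairTripleMult, Pi.add_apply, pow_add]
      ring
    · rw [hy, hz, hw]; ring
    · refine absurd ?_ h3.2
      rw [hw, sq]
      exact Nat.mul_dvd_mul_right h p
  · refine step (Sum.inl (i, j)) z 2 (by norm_num) (fun r => ?_) ?_ (fun h => ?_)
    · rw [hxy, hyz]
      simp only [pairTripleMult, Pi.add_apply, pow_add]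
      ring
    · rw [hy, hz]; ring
    · by_contra h4
      exact h3 ⟨h, h4⟩

theorem exists_pairTripleMult_pos {ι : Type*} [DecidableEq ι] (q : (ι × ι) ⊕ (ι × ι × ι)) :
    ∃ i, 1 ≤ pairTripleMult q i := by
  rcases q with ⟨i, j⟩ | ⟨i, j, l⟩ <;> exact ⟨i, by simp [pairTripleMult]; try omega⟩

theorem sum_pairTripleMult_inl {ι : Type*} [Fintype ι] [DecidableEq ι] (q : ι × ι) :
    ∑ i, pairTripleMult (Sum.inl q) i = 2 := by
  obtain ⟨i, j⟩ := q
  simp [pairTripleMult, Finset.sum_add_distrib]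

theorem sum_pairTripleMult_inr {ι : Type*} [Fintype ι] [DecidableEq ι] (q : ι × ι × ι) :
    ∑ i, pairTripleMult (Sum.inr q) i = 3 := by
  obtain ⟨i, j, l⟩ := q
  simp [pairTripleMult, Finset.sum_add_distrib]

/-- Rankin's trick for tuples with squarefull product. -/
theorem card_squarefull_tuples_le_prod {ι : Type*} [Fintype ι] [DecidableEq ι]
    (S : Finset (ι → ℕ)) (N : ℕ) (hS : ∀ x ∈ S, ∀ i, 1 ≤ x i ∧ x i ≤ N)
    (hsq : ∀ x ∈ S, IsSquarefull (∏ i, x i)) :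
    (S.card : ℝ) ≤ √N ^ Fintype.card ι *
      ∏ q : (ι × ι) ⊕ (ι × ι × ι), ∑ n ∈ Finset.Icc 1 N, ((√n)⁻¹) ^ (∑ i, pairTripleMult q i) := by
  have hex : ∀ x : ι → ℕ, ∃ d : (ι × ι) ⊕ (ι × ι × ι) → ℕ,
      x ∈ S → ∀ i, x i = ∏ q, d q ^ pairTripleMult q i := by
    intro x
    by_cases hx : x ∈ S
    · obtain ⟨d, hd⟩ := exists_eq_prod_pow_of_isSquarefull _ x rfl
        (Finset.prod_pos fun i _ => (hS x hx i).1).ne' (hsq x hx)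
      exact ⟨d, fun _ => hd⟩
    · exact ⟨1, fun h => absurd h hx⟩
  choose D hD using hex
  have hinj : Set.InjOn D S := fun x hx y hy hxy => by
    funext i
    rw [hD x hx i, hD y hy i, hxy]
  have hmem : ∀ x ∈ S, D x ∈ Fintype.piFinset fun _ => Finset.Icc 1 N := by
    intro x hx
    refine Fintype.mem_piFinset.2 fun q => ?_
    obtain ⟨i, hi⟩ := exists_pairTripleMult_pos q
    have hdvd : D x q ∣ x i := by
      rw [hD x hx i]
      exact (dvd_pow_self _ (by omega)).trans
        (Finset.dvd_prod_of_mem (fun q => D x q ^ pairTripleMult q i) (Finset.mem_univ q))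
    have := hS x hx i
    exact Finset.mem_Icc.2 ⟨Nat.pos_of_dvd_of_pos hdvd this.1, (Nat.le_of_dvd this.1 hdvd).trans this.2⟩
  -- Rankin's weight `∏ √(N / x i) ≥ 1` factors over the parameters `d q`, so the sum over all
  -- parameters becomes a product.
  have hterm : ∀ x ∈ S, (1 : ℝ) ≤ √N ^ Fintype.card ι *
      ∏ q, ((√(D x q))⁻¹) ^ (∑ i, pairTripleMult q i) := by
    intro x hx
    have h1 : ∏ q, ((√(D x q))⁻¹) ^ (∑ i, pairTripleMult q i) = ∏ i, (√(x i))⁻¹ := by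
      simp_rw [← Finset.prod_pow_eq_pow_sum]
      rw [Finset.prod_comm]
      refine Finset.prod_congr rfl fun i _ => ?_
      simp_rw [inv_pow, Finset.prod_inv_distrib]
      rw [inv_inj, eq_comm, Real.sqrt_eq_iff_eq_sq (by positivity)
        (Finset.prod_nonneg fun _ _ => by positivity), ← Finset.prod_pow]
      conv_lhs => rw [hD x hx i]
      push_cast
      refine Finset.prod_congr rfl fun q _ => ?_
      rw [← pow_mul, mul_comm, pow_mul, Real.sq_sqrt (by positivity)]
    rw [h1, ← Finset.card_univ, ← Finset.prod_const, ← Finset.prod_mul_distrib]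
    refine Finset.one_le_prod fun i _ => ?_
    obtain ⟨ha, hb⟩ := hS x hx i
    have h0 : (0 : ℝ) < x i := by exact_mod_cast ha
    rw [← div_eq_mul_inv, one_le_div (Real.sqrt_pos.2 h0)]
    exact Real.sqrt_le_sqrt (by exact_mod_cast hb)
  calc (S.card : ℝ) = ∑ x ∈ S, (1 : ℝ) := by simp
    _ ≤ ∑ x ∈ S, √N ^ Fintype.card ι * ∏ q, ((√(D x q))⁻¹) ^ (∑ i, pairTripleMult q i) :=
        Finset.sum_le_sum hterm
    _ = √N ^ Fintype.card ι *
        ∑ d ∈ S.image D, ∏ q, ((√(d q))⁻¹) ^ (∑ i, pairTripleMult q i) := by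
        rw [Finset.sum_image hinj, Finset.mul_sum]
    _ ≤ √N ^ Fintype.card ι * ∑ d ∈ Fintype.piFinset fun _ => Finset.Icc 1 N,
          ∏ q, ((√(d q))⁻¹) ^ (∑ i, pairTripleMult q i) := by
        gcongr
        exact Finset.image_subset_iff.2 hmem
    _ = _ := by
        rw [Finset.prod_univ_sum]

theorem sum_inv_sqrt_pow_three_le (N : ℕ) : ∑ n ∈ Finset.Icc 1 N, ((√n)⁻¹) ^ 3 ≤ (3 : ℝ) := by
  -- The term `2 / √N` strengthens the claim so that the induction telescopes.
  have h : ∀ N : ℕ, 1 ≤ N → ∑ n ∈ Finset.Icc 1 N, ((√n)⁻¹) ^ 3 ≤ (3 : ℝ) - 2 * (√N)⁻¹ := by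
    intro N hN
    induction N, hN using Nat.le_induction with
    | base => norm_num
    | succ n hn ih =>
      rw [Finset.sum_Icc_succ_top (by omega)]
      have ha : 0 < √(n : ℝ) := Real.sqrt_pos.2 (by exact_mod_cast hn)
      have hb : 0 < √((n + 1 : ℕ) : ℝ) := Real.sqrt_pos.2 (by positivity)
      have ha2 : √(n : ℝ) ^ 2 = n := Real.sq_sqrt (by positivity)
      have hb2 : √((n + 1 : ℕ) : ℝ) ^ 2 = n + 1 := by rw [Real.sq_sqrt (by positivity)]; simp
      set a := √(n : ℝ)
      set b := √((n + 1 : ℕ) : ℝ)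
      have hab : a ≤ b := Real.sqrt_le_sqrt (by push_cast; linarith)
      have key : (b⁻¹) ^ 3 ≤ 2 * a⁻¹ - 2 * b⁻¹ := by
        have e : 2 * a⁻¹ - 2 * b⁻¹ - (b⁻¹) ^ 3 = (2 * b ^ 2 * (b - a) - a) / (a * b ^ 3) := by
          field_simp
        have h1 : (b - a) * (b + a) = 1 := by ring_nf; linarith
        have h2 : 1 ≤ (b - a) * (2 * b) := by nlinarith
        have : 0 ≤ (2 * b ^ 2 * (b - a) - a) / (a * b ^ 3) := by
          apply div_nonneg _ (by positivity)
          nlinarith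
        linarith
      linarith
  rcases Nat.eq_zero_or_pos N with rfl | hN
  · simp
  · have := h N hN
    have h2 : (0 : ℝ) ≤ 2 * (√N)⁻¹ := by positivity
    linarith

theorem sum_inv_sqrt_sq_le (N : ℕ) : ∑ n ∈ Finset.Icc 1 N, ((√n)⁻¹) ^ 2 ≤ 1 + Real.log N := by
  have h1 := harmonic_le_one_add_log N
  rw [harmonic_eq_sum_Icc] at h1
  push_cast at h1
  refine le_trans (le_of_eq (Finset.sum_congr rfl fun n _ => ?_)) h1
  rw [inv_pow, Real.sq_sqrt (by positivity)]

/-- Each pair contributes a harmonic sum, hence a logarithm; each triple contributes a convergent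
sum, hence a constant. -/
theorem card_squarefull_tuples_le {ι : Type*} [Fintype ι] [DecidableEq ι]
    (S : Finset (ι → ℕ)) (N : ℕ) (hS : ∀ x ∈ S, ∀ i, 1 ≤ x i ∧ x i ≤ N)
    (hsq : ∀ x ∈ S, IsSquarefull (∏ i, x i)) :
    (S.card : ℝ) ≤ √N ^ Fintype.card ι *
      ((1 + Real.log N) ^ (Fintype.card ι ^ 2) * 3 ^ (Fintype.card ι ^ 3)) := by
  refine (card_squarefull_tuples_le_prod S N hS hsq).trans ?_
  rw [Fintype.prod_sum_type]
  simp_rw [sum_pairTripleMult_inl, sum_pairTripleMult_inr]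
  rw [Finset.prod_const, Finset.prod_const, Finset.card_univ, Finset.card_univ,
    Fintype.card_prod, Fintype.card_prod, Fintype.card_prod, ← sq, ← pow_succ']
  gcongr
  · exact sum_inv_sqrt_sq_le N
  · exact sum_inv_sqrt_pow_three_le N

/-- Clear denominators: if `p ∣ z i`, every term but the `i`-th is divisible by `p`, hence so is
that one, which is a unit times the product of the other entries. -/
theorem isSquarefull_prod_of_sum_inv_eq_zero {ι : Type*} [Fintype ι] [DecidableEq ι]
    (z : ι → ℕ) (hz : ∀ i, 1 ≤ z i) (ε : ι → ℤ) (hε : ∀ i, IsUnit (ε i))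
    (h : ∑ i, (ε i : ℚ) * (z i : ℚ)⁻¹ = 0) : IsSquarefull (∏ i, z i) := by
  intro p hp hpz
  by_contra hsq
  obtain ⟨i, _, hi⟩ := (hp.prime.dvd_finsetProd_iff _).1 hpz
  have hint : ∑ l, ε l * ∏ j ∈ Finset.univ.erase l, (z j : ℤ) = 0 := by
    have h2 : ∑ l, (ε l : ℚ) * ∏ j ∈ Finset.univ.erase l, (z j : ℚ) = 0 := by
      rw [← mul_zero (∏ j, (z j : ℚ)), ← h, Finset.mul_sum]
      refine Finset.sum_congr rfl fun l _ => ?_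
      have : (z l : ℚ) ≠ 0 := by have := hz l; positivity
      rw [← Finset.mul_prod_erase Finset.univ _ (Finset.mem_univ l)]
      field_simp
    exact_mod_cast h2
  rw [← Finset.add_sum_erase _ _ (Finset.mem_univ i)] at hint
  have hrest : (p : ℤ) ∣ ∑ l ∈ Finset.univ.erase i, ε l * ∏ j ∈ Finset.univ.erase l, (z j : ℤ) := by
    refine Finset.dvd_sum fun l hl => Dvd.dvd.mul_left ?_ _
    refine dvd_trans (Int.natCast_dvd_natCast.2 hi)
      (Finset.dvd_prod_of_mem (fun j => (z j : ℤ)) ?_)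
    exact Finset.mem_erase.2 ⟨(Finset.ne_of_mem_erase hl).symm, Finset.mem_univ _⟩
  have hmain := (dvd_add_left hrest).1 (hint ▸ dvd_zero (p : ℤ))
  rw [(hε i).dvd_mul_left] at hmain
  have hmain' : p ∣ ∏ j ∈ Finset.univ.erase i, z j := by exact_mod_cast hmain
  apply hsq
  rw [← Finset.mul_prod_erase Finset.univ _ (Finset.mem_univ i), sq]
  exact mul_dvd_mul hi hmain'

/-- The number of solutions of `∑ 1/x = ∑ 1/y` in rationals. -/
theorem coincidences_rat_le (m N k : ℕ) :
    (coincidences (Fintype.piFinset fun _ : Fin k => coprimeInterval m N)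
      (fun p => ∑ i, ((p i : ℕ) : ℚ)⁻¹) : ℝ) ≤
    (N : ℝ) ^ k * ((1 + Real.log N) ^ (4 * k ^ 2) * 3 ^ (8 * k ^ 3)) := by
  classical
  unfold coincidences
  set P := Finset.filter (fun p : (Fin k → ℕ) × (Fin k → ℕ) =>
    ∑ i, ((p.1 i : ℕ) : ℚ)⁻¹ = ∑ i, ((p.2 i : ℕ) : ℚ)⁻¹)
    ((Fintype.piFinset fun _ : Fin k => coprimeInterval m N) ×ˢ
      (Fintype.piFinset fun _ : Fin k => coprimeInterval m N)) with hP
  have hinj : Function.Injective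
      (fun p : (Fin k → ℕ) × (Fin k → ℕ) => (Sum.elim p.1 p.2 : Fin k ⊕ Fin k → ℕ)) := by
    intro p q hpq
    exact Prod.ext (funext fun i => congrFun hpq (Sum.inl i))
      (funext fun i => congrFun hpq (Sum.inr i))
  have hrange : ∀ p ∈ P, ∀ i, 1 ≤ (Sum.elim p.1 p.2 : Fin k ⊕ Fin k → ℕ) i ∧
      (Sum.elim p.1 p.2 : Fin k ⊕ Fin k → ℕ) i ≤ N := by
    intro p hp
    rw [hP, Finset.mem_filter, Finset.mem_product, Fintype.mem_piFinset,
      Fintype.mem_piFinset] at hp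
    rintro (i | i)
    · exact (mem_coprimeInterval.1 (hp.1.1 i)).1
    · exact (mem_coprimeInterval.1 (hp.1.2 i)).1
  -- Both sides of the equation are glued into one tuple of length `2k`, with sign `-1` on the
  -- second half.
  have h := card_squarefull_tuples_le
    (P.image fun p => (Sum.elim p.1 p.2 : Fin k ⊕ Fin k → ℕ)) N
    (by
      intro x hx
      obtain ⟨p, hp, rfl⟩ := Finset.mem_image.1 hx
      exact hrange p hp)
    (by
      intro x hx
      obtain ⟨p, hp, rfl⟩ := Finset.mem_image.1 hx
      refine isSquarefull_prod_of_sum_inv_eq_zero _ (fun i => (hrange p hp i).1)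
        (Sum.elim (fun _ => 1) (fun _ => -1)) (by rintro (i | i) <;> simp) ?_
      have := (Finset.mem_filter.1 hp).2
      simp only [Fintype.sum_sum_type, Sum.elim_inl, Sum.elim_inr]
      simp [this])
  rw [Finset.card_image_of_injective _ hinj, Fintype.card_sum, Fintype.card_fin, ← two_mul,
    pow_mul √(N : ℝ), Real.sq_sqrt (by positivity)] at h
  convert h using 4 <;> ring

/-! ### Bounds for the number of solutions modulo `m`. -/

theorem card_coprimeInterval_le (m N : ℕ) : (coprimeInterval m N).card ≤ N :=
  (Finset.card_filter_le _ _).trans (by simp)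

/-- The inverse fixes `x` modulo `m`, so `x / m` determines `x`. -/
theorem card_coprimeInterval_inv_eq_le (m N : ℕ) (c : ZMod m) :
    ((coprimeInterval m N).filter (fun x : ℕ => (x : ZMod m)⁻¹ = c)).card ≤ N / m + 1 := by
  rw [← Finset.card_range (N / m + 1)]
  refine Finset.card_le_card_of_injOn (fun x : ℕ => x / m) (fun x hx => ?_) (fun x hx y hy hxy => ?_)
  · have := (mem_coprimeInterval.1 (Finset.mem_filter.1 hx).1).1.2
    simpa [Nat.lt_succ_iff] using Nat.div_le_div_right this
  · have h1 := natCast_mul_inv_of_mem (Finset.mem_filter.1 hx).1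
    have h2 := natCast_mul_inv_of_mem (Finset.mem_filter.1 hy).1
    rw [(Finset.mem_filter.1 hx).2] at h1
    rw [(Finset.mem_filter.1 hy).2] at h2
    have h3 : (x : ZMod m) = y := by linear_combination (y : ZMod m) * h1 - (x : ZMod m) * h2
    have h4 : x % m = y % m := (ZMod.natCast_eq_natCast_iff x y m).1 h3
    rw [← Nat.div_add_mod x m, ← Nat.div_add_mod y m, h4]
    simp only at hxy
    rw [hxy]

/-- The last `n` entries force the value of `v` at the first one. -/
theorem card_tuples_sum_eq_le {A G : Type*} [DecidableEq G] [AddCommGroup G] (s : Finset A)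
    (v : A → G) (K : ℕ) (hK : ∀ c, (s.filter (fun x => v x = c)).card ≤ K) (n : ℕ) (c : G) :
    ((Fintype.piFinset fun _ : Fin (n + 1) => s).filter (fun p => ∑ i, v (p i) = c)).card
      ≤ K * s.card ^ n := by
  classical
  set F := (Fintype.piFinset fun _ : Fin (n + 1) => s).filter (fun p => ∑ i, v (p i) = c) with hF
  have hmem : ∀ p ∈ F, (∀ i, p i ∈ s) ∧ ∑ i, v (p i) = c := fun p hp => by
    rw [hF, Finset.mem_filter, Fintype.mem_piFinset] at hp
    exact hp
  have himg : F.image Fin.tail ⊆ Fintype.piFinset fun _ : Fin n => s := by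
    refine Finset.image_subset_iff.2 fun p hp => Fintype.mem_piFinset.2 fun i => ?_
    exact (hmem p hp).1 i.succ
  have himg' : (F.image Fin.tail).card ≤ s.card ^ n := by
    simpa using Finset.card_le_card himg
  refine (Finset.card_le_mul_card_image F K fun r _ => ?_).trans (Nat.mul_le_mul_left K himg')
  refine le_trans ?_ (hK (c - ∑ i, v (r i)))
  refine Finset.card_le_card_of_injOn (fun p => p 0) (fun p hp => ?_) (fun p hp q hq hpq => ?_)
  · obtain ⟨h1, h2⟩ := Finset.mem_filter.1 hp
    have h3 := hmem p h1
    refine Finset.mem_filter.2 ⟨h3.1 0, ?_⟩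
    rw [← h3.2, Fin.sum_univ_succ, ← h2]
    simp [Fin.tail]
  · have h1 := (Finset.mem_filter.1 hp).2
    have h2 := (Finset.mem_filter.1 hq).2
    rw [← Fin.cons_self_tail p, ← Fin.cons_self_tail q, h1, h2]
    simp only at hpq
    rw [hpq]

/-- The bound for the number of solutions obtained by fixing all variables but one. -/
theorem coincidences_mod_le_trivial (m N k : ℕ) (hm : 0 < m) (hk : 1 ≤ k) :
    coincidences (Fintype.piFinset fun _ : Fin k => coprimeInterval m N)
      (fun p => ∑ i, ((p i : ℕ) : ZMod m)⁻¹) ≤ (N / m + 1) * N ^ (2 * k - 1) := by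
  have : NeZero m := ⟨hm.ne'⟩
  obtain ⟨n, rfl⟩ : ∃ n, k = n + 1 := ⟨k - 1, by omega⟩
  set S := Fintype.piFinset fun _ : Fin (n + 1) => coprimeInterval m N
  have hC := card_coprimeInterval_le m N
  rw [coincidences_eq_sum_sq S _ Finset.univ (by simp)]
  calc ∑ c : ZMod m, (S.filter (fun p => ∑ i, ((p i : ℕ) : ZMod m)⁻¹ = c)).card ^ 2
      ≤ ∑ c : ZMod m, ((N / m + 1) * N ^ n) *
          (S.filter (fun p => ∑ i, ((p i : ℕ) : ZMod m)⁻¹ = c)).card := by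
        refine Finset.sum_le_sum fun c _ => ?_
        rw [sq]
        refine Nat.mul_le_mul_right _ ?_
        refine (card_tuples_sum_eq_le (coprimeInterval m N) (fun x : ℕ => (x : ZMod m)⁻¹) _
          (card_coprimeInterval_inv_eq_le m N) n c).trans ?_
        gcongr
    _ = ((N / m + 1) * N ^ n) * S.card := by
        rw [← Finset.mul_sum, ← Finset.card_eq_sum_card_fiberwise (fun x _ => by simp)]
    _ ≤ ((N / m + 1) * N ^ n) * N ^ (n + 1) := by
        refine Nat.mul_le_mul_left _ ?_
        simpa [S] using Nat.pow_le_pow_left hC (n + 1)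
    _ = _ := by rw [mul_assoc, ← pow_add]; congr 2; omega

/-- The lattice argument costs a power of `log N`, which `log m` controls only for `N < m`; for
larger `N` the trivial bound has no logarithm. The exponent `90 * k ^ 3` is generous: `1 + 8 * k ^ 2
+ 16 * k ^ 3` is what is needed. -/
theorem coincidences_mod_lt (m : ℕ) (hm : 2 ≤ m) (N : ℕ) (hN : 1 ≤ N) (k : ℕ) (hk : 1 ≤ k) :
    (coincidences (Fintype.piFinset fun _ : Fin k => coprimeInterval m N)
      (fun p => ∑ i, ((p i : ℕ) : ZMod m)⁻¹) : ℝ) <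
    (2 * (k : ℝ)) ^ (90 * k ^ 3) * Real.log m ^ (4 * k ^ 2) *
      (((N : ℝ) ^ (2 * k - 1) / m + 1) * (N : ℝ) ^ k) := by
  have hk' : (1 : ℝ) ≤ k := by exact_mod_cast hk
  have hm' : (2 : ℝ) ≤ m := by exact_mod_cast hm
  have hN' : (1 : ℝ) ≤ N := by exact_mod_cast hN
  have hk3 : k ^ 2 ≤ k ^ 3 := Nat.pow_le_pow_right hk (by norm_num)
  have hk1 : 1 ≤ k ^ 2 := Nat.one_le_pow _ _ hk
  -- Gives `1 ≤ 2 * log m`, which absorbs additive constants into the logarithm even at `m = 2`.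
  have hlog : 1 / 2 ≤ Real.log m := by
    have := Real.log_two_gt_d9
    have := Real.log_le_log (by norm_num) hm'
    linarith
  set L := Real.log m
  have hL : 0 < L := by linarith
  set E := (N : ℝ) ^ (2 * k - 1) / m with hE
  have hE0 : 0 ≤ E := by positivity
  rcases lt_or_ge N m with hNm | hNm
  · have hlogN : 1 + Real.log N ≤ 4 * L := by
      have : Real.log N ≤ L := Real.log_le_log (by linarith) (by exact_mod_cast hNm.le)
      linarith
    have hlogN0 : 0 ≤ Real.log N := Real.log_nonneg hN'
    refine (coincidences_mod_le_rat m hm N hN k hk).trans_lt ?_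
    calc 2 * (k * (N : ℝ) ^ (2 * k - 1) / m + 1) *
          (coincidences (Fintype.piFinset fun _ : Fin k => coprimeInterval m N)
            (fun p => ∑ i, ((p i : ℕ) : ℚ)⁻¹) : ℝ)
        ≤ 2 * (k * (E + 1)) *
          ((N : ℝ) ^ k * ((4 * L) ^ (4 * k ^ 2) * 4 ^ (8 * k ^ 3))) := by
          -- The base `3` is weakened to `4` so that all constants are powers of `2 ≤ 2 * k`.
          have h1 := coincidences_rat_le m N k
          have h2 : k * (N : ℝ) ^ (2 * k - 1) / m + 1 ≤ k * (E + 1) := by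
            rw [mul_div_assoc]; linarith
          refine mul_le_mul (by linarith) (h1.trans ?_) (by positivity) (by positivity)
          gcongr
          norm_num
      _ = (2 * k) * 2 ^ (8 * k ^ 2 + 16 * k ^ 3) * (L ^ (4 * k ^ 2) * ((E + 1) * (N : ℝ) ^ k)) := by
          rw [mul_pow, show (4 : ℝ) = 2 ^ 2 by norm_num, ← pow_mul, ← pow_mul, pow_add]
          ring_nf
      _ ≤ (2 * k) * (2 * k) ^ (8 * k ^ 2 + 16 * k ^ 3) *
            (L ^ (4 * k ^ 2) * ((E + 1) * (N : ℝ) ^ k)) := by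
          gcongr
          linarith
      _ < (2 * k) ^ (90 * k ^ 3) * (L ^ (4 * k ^ 2) * ((E + 1) * (N : ℝ) ^ k)) := by
          rw [← pow_succ']
          gcongr
          · linarith
          · omega
      _ = _ := by ring
  · have h1 : (coincidences (Fintype.piFinset fun _ : Fin k => coprimeInterval m N)
        (fun p => ∑ i, ((p i : ℕ) : ZMod m)⁻¹) : ℝ) ≤ ((N / m : ℕ) + 1) * (N : ℝ) ^ (2 * k - 1) := by
      exact_mod_cast coincidences_mod_le_trivial m N k (by omega) hk
    have h2 : ((N / m : ℕ) : ℝ) + 1 ≤ 2 * (N / m) := by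
      have : ((N / m : ℕ) : ℝ) ≤ N / m := Nat.cast_div_le
      have : (1 : ℝ) ≤ N / m := by
        rw [one_le_div (by linarith)]; exact_mod_cast hNm
      linarith
    calc (coincidences (Fintype.piFinset fun _ : Fin k => coprimeInterval m N)
        (fun p => ∑ i, ((p i : ℕ) : ZMod m)⁻¹) : ℝ)
        ≤ 2 * (N / m) * (N : ℝ) ^ (2 * k - 1) := h1.trans (by gcongr)
      _ = 2 * (E * N) := by rw [hE]; ring
      _ ≤ 2 * ((E + 1) * (N : ℝ) ^ k) := by
          gcongr
          · linarith
          · exact le_self_pow₀ hN' (by omega)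
      _ ≤ 2 * (2 * L) ^ (4 * k ^ 2) * ((E + 1) * (N : ℝ) ^ k) := by
          have h3 : 1 ≤ (2 * L) ^ (4 * k ^ 2) := one_le_pow₀ (by linarith)
          rw [mul_assoc 2]
          exact mul_le_mul_of_nonneg_left (le_mul_of_one_le_left (by positivity) h3) (by norm_num)
      _ = 2 ^ (4 * k ^ 2 + 1) * L ^ (4 * k ^ 2) * ((E + 1) * (N : ℝ) ^ k) := by
          rw [mul_pow, pow_succ]; ring
      _ ≤ (2 * k) ^ (4 * k ^ 2 + 1) * L ^ (4 * k ^ 2) * ((E + 1) * (N : ℝ) ^ k) := by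
          gcongr
          linarith
      _ < _ := by
          gcongr
          · linarith
          · omega

/-! ### Assembly of the final bound. -/

theorem eMod_eq_stdAddChar (m : ℕ) [NeZero m] (a : ℤ) (x y : ℕ) :
    eMod m (a * (invMod m x : ℤ) * (invMod m y : ℤ)) =
      ZMod.stdAddChar (((a : ZMod m) * (x : ZMod m)⁻¹) * (y : ZMod m)⁻¹) := by
  rw [eMod, ← ZMod.stdAddChar_coe]
  simp [invMod]

theorem coincidences_sum_mul_left {A G : Type*} [CommRing G] [DecidableEq G] {k : ℕ}
    (s : Finset (Fin k → A)) (v : A → G) {a : G} (ha : IsUnit a) :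
    coincidences s (fun p => ∑ i, a * v (p i)) = coincidences s (fun p => ∑ i, v (p i)) := by
  unfold coincidences
  simp_rw [← Finset.mul_sum, ha.mul_right_inj]

/-- The factor `m` is shared as `√m * √m` between the two variables; each share produces one factor
of the stated bound. -/
theorem pow_mul_solutions_factor {m N : ℝ} (hm : 0 < m) (hN : 0 < N) {k l : ℕ} (hk : 1 ≤ k)
    (hl : 1 ≤ l) :
    √m * (N ^ (2 * k * (l - 1)) * ((N ^ (2 * k - 1) / m + 1) * N ^ k)) =
      (N ^ (k - 1) / √m + √m / N ^ k) * N ^ (2 * k * l) := by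
  obtain ⟨i, rfl⟩ : ∃ n, k = n + 1 := ⟨k - 1, by omega⟩
  obtain ⟨j, rfl⟩ : ∃ n, l = n + 1 := ⟨l - 1, by omega⟩
  have hs : 0 < √m := Real.sqrt_pos.2 hm
  have h : m = √m ^ 2 := (Real.sq_sqrt hm.le).symm
  set r := √m
  rw [h, show 2 * (i + 1) - 1 = 2 * i + 1 by omega, Nat.add_sub_cancel, Nat.add_sub_cancel,
    show 2 * (i + 1) * (j + 1) = 2 * (i + 1) * j + (i + 1) + (i + 1) by ring, pow_add _ _ (i + 1),
    pow_add _ _ (i + 1)]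
  field_simp
  ring

theorem theorem3 (m : ℕ) (hm : 2 ≤ m) (a : ℤ) (ha : IsCoprime a (m : ℤ))
    (N₁ N₂ : ℕ) (hN₁ : 1 ≤ N₁) (hN₂ : 1 ≤ N₂)
    (k₁ k₂ : ℕ) (hk₁ : 1 ≤ k₁) (hk₂ : 1 ≤ k₂)
    (α₁ α₂ : ℕ → ℂ)
    (hα₁ : ∀ x ∈ Finset.Icc 1 N₁, ‖α₁ x‖ ≤ 1)
    (hα₂ : ∀ x ∈ Finset.Icc 1 N₂, ‖α₂ x‖ ≤ 1) :
    ‖bilinearKloosterman m a N₁ N₂ α₁ α₂‖ <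
      (2 * (k₁ : ℝ)) ^ (45 * (k₁ : ℝ) ^ 2 / (k₂ : ℝ)) *
      (2 * (k₂ : ℝ)) ^ (45 * (k₂ : ℝ) ^ 2 / (k₁ : ℝ)) *
      Real.log (m : ℝ) ^ (2 * ((k₁ : ℝ) / (k₂ : ℝ) + (k₂ : ℝ) / (k₁ : ℝ))) *
      ((N₁ : ℝ) ^ (k₁ - 1) / Real.sqrt m + Real.sqrt m / (N₁ : ℝ) ^ k₁) ^
        (1 / (2 * (k₁ : ℝ) * (k₂ : ℝ))) *
      ((N₂ : ℝ) ^ (k₂ - 1) / Real.sqrt m + Real.sqrt m / (N₂ : ℝ) ^ k₂) ^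
        (1 / (2 * (k₁ : ℝ) * (k₂ : ℝ))) *
      ((N₁ : ℝ) * (N₂ : ℝ)) := by
  have : NeZero m := ⟨by omega⟩
  have hunit : IsUnit (a : ZMod m) := by
    obtain ⟨b, c, hbc⟩ := ha
    have h := congrArg (Int.cast : ℤ → ZMod m) hbc
    push_cast at h
    rw [ZMod.natCast_self, mul_zero, add_zero] at h
    exact IsUnit.of_mul_eq_one_right _ h
  have hk₁' : (0 : ℝ) < k₁ := by exact_mod_cast hk₁
  have hk₂' : (0 : ℝ) < k₂ := by exact_mod_cast hk₂
  have hN₁' : (0 : ℝ) < N₁ := by exact_mod_cast hN₁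
  have hN₂' : (0 : ℝ) < N₂ := by exact_mod_cast hN₂
  have hm' : (0 : ℝ) < m := by exact_mod_cast (by omega : 0 < m)
  have hlog : 0 < Real.log m := Real.log_pos (by exact_mod_cast hm)
  have hsum := norm_bilinear_pow_le_coincidences (ZMod.stdAddChar (N := m))
    (ZMod.isPrimitive_stdAddChar m) (coprimeInterval m N₁) (coprimeInterval m N₂)
    (fun x => (a : ZMod m) * (x : ZMod m)⁻¹) (fun x => (x : ZMod m)⁻¹) α₁ α₂
    (fun x hx => hα₁ x (Finset.mem_filter.1 hx).1) (fun x hx => hα₂ x (Finset.mem_filter.1 hx).1)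
    hk₁ hk₂
  simp_rw [← eMod_eq_stdAddChar] at hsum
  rw [coincidences_sum_mul_left _ (fun x : ℕ => (x : ZMod m)⁻¹) hunit] at hsum
  change ‖bilinearKloosterman m a N₁ N₂ α₁ α₂‖ ^ _ ≤ _ at hsum
  have hJ₁ := coincidences_mod_lt m hm N₁ hN₁ k₁ hk₁
  have hJ₂ := coincidences_mod_lt m hm N₂ hN₂ k₂ hk₂
  have hC₁ : ((coprimeInterval m N₁).card : ℝ) ≤ N₁ := by
    exact_mod_cast card_coprimeInterval_le m N₁
  have hC₂ : ((coprimeInterval m N₂).card : ℝ) ≤ N₂ := by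
    exact_mod_cast card_coprimeInterval_le m N₂
  set J₁ : ℝ := ((coincidences (Fintype.piFinset fun _ : Fin k₁ => coprimeInterval m N₁)
      (fun p => ∑ i, ((p i : ℕ) : ZMod m)⁻¹) : ℕ) : ℝ)
  set J₂ : ℝ := ((coincidences (Fintype.piFinset fun _ : Fin k₂ => coprimeInterval m N₂)
      (fun p => ∑ i, ((p i : ℕ) : ZMod m)⁻¹) : ℕ) : ℝ)
  have hJ₁0 : 0 ≤ J₁ := Nat.cast_nonneg _
  have hJ₂0 : 0 ≤ J₂ := Nat.cast_nonneg _
  set D₁ := (N₁ : ℝ) ^ (k₁ - 1) / Real.sqrt m + Real.sqrt m / (N₁ : ℝ) ^ k₁ with hD₁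
  set D₂ := (N₂ : ℝ) ^ (k₂ - 1) / Real.sqrt m + Real.sqrt m / (N₂ : ℝ) ^ k₂ with hD₂
  have hs : 0 < √(m : ℝ) := Real.sqrt_pos.2 hm'
  have hD₁0 : 0 < D₁ := by positivity
  have hD₂0 : 0 < D₂ := by positivity
  refine lt_of_pow_lt_pow_left₀ (2 * k₁ * k₂) (by positivity) (hsum.trans_lt ?_)
  -- Raising to the power `2 * k₁ * k₂` makes all exponents integers: `45 k₁² / k₂` becomes `90
  -- k₁³`, and the exponent of the logarithm becomes `4 k₁² + 4 k₂²`.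
  have hroot : ∀ (x e : ℝ) (n : ℕ), 0 ≤ x → e * (2 * k₁ * k₂) = n →
      (x ^ e) ^ (2 * k₁ * k₂) = x ^ n := by
    intro x e n hx he
    rw [← Real.rpow_natCast, ← Real.rpow_mul hx, ← Real.rpow_natCast x n, ← he]
    push_cast
    rfl
  simp only [mul_pow _ _ (2 * k₁ * k₂)]
  rw [hroot (2 * k₁) _ (90 * k₁ ^ 3) (by positivity) (by push_cast; field_simp; ring),
    hroot (2 * k₂) _ (90 * k₂ ^ 3) (by positivity) (by push_cast; field_simp; ring),
    hroot (Real.log m) _ (4 * k₁ ^ 2 + 4 * k₂ ^ 2) hlog.le (by push_cast; field_simp; ring),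
    hroot D₁ _ 1 hD₁0.le (by push_cast; field_simp),
    hroot D₂ _ 1 hD₂0.le (by push_cast; field_simp), pow_one, pow_one]
  have e₁ := pow_mul_solutions_factor hm' hN₁' hk₁ hk₂
  have e₂ := pow_mul_solutions_factor hm' hN₂' hk₂ hk₁
  rw [show 2 * k₂ * k₁ = 2 * k₁ * k₂ by ring] at e₂
  rw [← hD₁] at e₁
  rw [← hD₂] at e₂
  have hsm : √(m : ℝ) * √(m : ℝ) = m := Real.mul_self_sqrt hm'.le
  set G₁ := ((N₁ : ℝ) ^ (2 * k₁ - 1) / m + 1) * (N₁ : ℝ) ^ k₁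
  set G₂ := ((N₂ : ℝ) ^ (2 * k₂ - 1) / m + 1) * (N₂ : ℝ) ^ k₂
  have hJJ : J₁ * J₂ < ((2 * (k₁ : ℝ)) ^ (90 * k₁ ^ 3) * Real.log m ^ (4 * k₁ ^ 2) * G₁) *
      ((2 * (k₂ : ℝ)) ^ (90 * k₂ ^ 3) * Real.log m ^ (4 * k₂ ^ 2) * G₂) :=
    mul_lt_mul'' hJ₁ hJ₂ hJ₁0 hJ₂0
  calc _ ≤ (N₁ : ℝ) ^ (2 * k₁ * (k₂ - 1)) * (N₂ : ℝ) ^ (2 * k₂ * (k₁ - 1)) * (m * (J₁ * J₂)) := by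
        rw [mul_assoc (m : ℝ)]
        gcongr
    _ < (N₁ : ℝ) ^ (2 * k₁ * (k₂ - 1)) * (N₂ : ℝ) ^ (2 * k₂ * (k₁ - 1)) * (m *
        (((2 * (k₁ : ℝ)) ^ (90 * k₁ ^ 3) * Real.log m ^ (4 * k₁ ^ 2) * G₁) *
        ((2 * (k₂ : ℝ)) ^ (90 * k₂ ^ 3) * Real.log m ^ (4 * k₂ ^ 2) * G₂))) := by
        gcongr
    _ = (2 * (k₁ : ℝ)) ^ (90 * k₁ ^ 3) * (2 * (k₂ : ℝ)) ^ (90 * k₂ ^ 3) *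
        Real.log m ^ (4 * k₁ ^ 2 + 4 * k₂ ^ 2) *
        ((√m * ((N₁ : ℝ) ^ (2 * k₁ * (k₂ - 1)) * G₁)) *
          (√m * ((N₂ : ℝ) ^ (2 * k₂ * (k₁ - 1)) * G₂))) := by
        rw [pow_add (Real.log m), mul_mul_mul_comm (√(m : ℝ)) _ (√(m : ℝ)), hsm]
        ring
    _ = _ := by
        rw [e₁, e₂]; ring
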